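/- Let $X$ be a complex Hilbert space with inner product $\langle\cdot,\cdot\rangle$ linear in its first argument, let $A\in\mathcal B(X)$, and let $\{\varphi_n\}_{n\ge1}$ be an unconditional basis of $X$ consisting of eigenvectors of $A$, with eigenvalues written $A\varphi_n=-\lambda_n\varphi_n$. (A sequence of nonzero vectors $\varphi_n$ is an unconditional basis if its linear span is dense and there are $c_1,c_2>0$ with $c_1\sum|a_n|^2\|\varphi_n\|^2\le\|\sum a_n\varphi_n\|^2\le c_2\sum|a_n|^2\|\varphi_n\|^2$ for all finite sequences $(a_n)$.) Let $b\in X$ and $Bx=\langle x,b\rangle$, $B:X\to\mathbb C$. For bounded operators $A:X\to X$ and $B:X\to Y$, the pair $(A,B)$ is exactly observable at infinite time (EOB) for the discrete system $x_{k+1}=Ax_k,\ y_k=Bx_k$ if $\Psi x=(BA^kx)_{k\ge0}$ defines a continuous map $\Psi:X\to\ell^2(\mathbb Z_+,Y)$ that is bounded from below ($\|\Psi x\|\ge c\|x\|$ for all $x\in X$ and some $c>0$); it is EOB for the continuous system $\dot x=Ax,\ y=Bx$ if $(\Psi x)(t)=Be^{tA}x$ defines a continuous map $\Psi:X\to L^2([0,\infty),Y)$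 that is bounded from below. Let $M(z)=\frac{1-z}{1+z}$ and assume that there is $\varepsilon>0$ with $|\lambda_n+1|>\varepsilon$ for all $n$. Then: (a) $1-A$ is invertible in $\mathcal B(X)$, and the bounded operator $M(A):=-(1+A)(1-A)^{-1}$ satisfies $M(A)\varphi_n=-M(\lambda_n)\varphi_n$ for all $n$ (that is, if $A=-\Lambda$ with $\Lambda\varphi_n=\lambda_n\varphi_n$, then $M(A)$ denotes $-M(\Lambda)$). (b) There is a unique $\widetilde b\in X$ with $\langle\widetilde b,\varphi_n\rangle=\frac{\sqrt2}{|1+\lambda_n|}\langle b,\varphi_n\rangle$ for all $n$; put $\widetilde Bx=\langle x,\widetilde b\rangle$. (c) The pair $(A,B)$ is EOB at infinite time for the discrete system if and only if the pair $(M(A),\widetilde B)$ is EOB at infinite time for the continuous system. -/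

import Mathlib

open MeasureTheory

/-- `φ` is an unconditional sequence: for some constants `0 < c₁, c₂`,
`c₁ ∑ |aₙ|² ‖φₙ‖² ≤ ‖∑ aₙ φₙ‖² ≤ c₂ ∑ |aₙ|² ‖φₙ‖²` for all finite sums. -/
def IsUnconditionalSeq {X : Type*} [NormedAddCommGroup X] [InnerProductSpace ℂ X]
    (φ : ℕ → X) : Prop :=
  ∃ c₁ c₂ : ℝ, 0 < c₁ ∧ 0 < c₂ ∧ ∀ (s : Finset ℕ) (a : ℕ → ℂ),
    c₁ * ∑ n ∈ s, ‖a n‖ ^ 2 * ‖φ n‖ ^ 2 ≤ ‖∑ n ∈ s, a n • φ n‖ ^ 2 ∧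
    ‖∑ n ∈ s, a n • φ n‖ ^ 2 ≤ c₂ * ∑ n ∈ s, ‖a n‖ ^ 2 * ‖φ n‖ ^ 2

/-- An unconditional basis: a complete unconditional sequence. -/
def IsUnconditionalBasis {X : Type*} [NormedAddCommGroup X] [InnerProductSpace ℂ X]
    (φ : ℕ → X) : Prop :=
  (Submodule.span ℂ (Set.range φ)).topologicalClosure = ⊤ ∧ IsUnconditionalSeq φ

/-- The pair `(A, B)` of the discrete system `x (k+1) = A x k`, `y k = B x k` is exactly observable
at infinite time: `Ψ x = (B Aᵏ x)_{k ≥ 0}` defines a continuous map `Ψ : X → ℓ²(ℤ₊, Y)`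
(`B` is admissible at infinite time), and `Ψ` is bounded from below. -/
def DiscreteEOB {X Y : Type*} [NormedAddCommGroup X] [InnerProductSpace ℂ X]
    [NormedAddCommGroup Y] [InnerProductSpace ℂ Y] (A : X →L[ℂ] X) (B : X →L[ℂ] Y) : Prop :=
  ∃ Ψ : X →L[ℂ] lp (fun _ : ℕ => Y) 2,
    (∀ (x : X) (k : ℕ), Ψ x k = B ((A ^ k) x)) ∧
    ∃ c : ℝ, 0 < c ∧ ∀ x : X, c * ‖x‖ ≤ ‖Ψ x‖

/-- The pair `(A, B)` of the continuous system `x' = A x`, `y = B x` is exactly observable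
at infinite time: `(Ψ x) t = B e^{tA} x` defines a continuous map `Ψ : X → L²([0,∞), Y)`
(`B` is admissible at infinite time), and `Ψ` is bounded from below. -/
def ContinuousEOB {X Y : Type*} [NormedAddCommGroup X] [InnerProductSpace ℂ X]
    [NormedAddCommGroup Y] [InnerProductSpace ℂ Y] (A : X →L[ℂ] X) (B : X →L[ℂ] Y) : Prop :=
  ∃ Ψ : X →L[ℂ] Lp Y 2 ((volume : Measure ℝ).restrict (Set.Ici 0)),
    (∀ x : X, ∀ᵐ t ∂((volume : Measure ℝ).restrict (Set.Ici 0)),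
      Ψ x t = B (NormedSpace.exp ((t : ℂ) • A) x)) ∧
    ∃ c : ℝ, 0 < c ∧ ∀ x : X, c * ‖x‖ ≤ ‖Ψ x‖

/-- The analysis operator `x ↦ ⟨x, b⟩` of a single vector `b` (linear in `x`; Mathlib's inner
product is linear in its second argument). -/
noncomputable def analysisOp {X : Type*} [NormedAddCommGroup X] [InnerProductSpace ℂ X]
    (b : X) : X →L[ℂ] ℂ :=
  innerSL ℂ b

/-- The map `M(z) = (1 - z) / (1 + z)`. -/
noncomputable def cayleyM (z : ℂ) : ℂ := (1 - z) / (1 + z)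

/-- `M` evaluated at a bounded operator: `M(T) = (1 - T)(1 + T)⁻¹` (meaningful if `1 + T` is
invertible). -/
noncomputable def cayleyMOp {X : Type*} [NormedAddCommGroup X] [InnerProductSpace ℂ X]
    (T : X →L[ℂ] X) : X →L[ℂ] X :=
  (1 - T) * Ring.inverse (1 + T)

/-- The Cayley transform of the system operator `A`. The eigenvalues of `A` are written as `-λₙ`,
that is `A = -Λ` with `Λ φₙ = λₙ φₙ`; the transform replaces `λₙ` by `M(λₙ)`, hence
`A = -Λ` by `-M(Λ)`, where `Λ = -A`. -/
noncomputable def cayleyTransform {X : Type*} [NormedAddCommGroup X] [InnerProductSpace ℂ X]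
    (A : X →L[ℂ] X) : X →L[ℂ] X :=
  -cayleyMOp (-A)

/-! ### Diagonal operators with respect to unconditional sequences -/

section Unconditional

variable {X : Type*} [NormedAddCommGroup X] [InnerProductSpace ℂ X] {φ : ℕ → X}

/-! On a finite combination of eigenvectors the two outputs are combinations of geometric sequences
`(-λₙ)ᵏ` and of exponentials `exp (-M(λₙ) t)`, so their `L²` norms depend only on Gram matrices.
Since `conj M(l) + M(l') = 2(1 - conj l · l') / ((1 + conj l)(1 + l'))`, the weights `√2/|1 + λₙ|`
make these matrices agree up to the unimodular factors `uₙ = (1 + λₙ)/|1 + λₙ|` (`gram_cayleyM_eq`).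
In an unconditional basis, replacing `aₙ` by `uₙ aₙ` changes the norm by at most a fixed factor in
either direction, so two-sided bounds pass between the systems on the span
(`FrameBoundsOn.span_of_eLpNorm_eq`) and extend to `X` by density (`FrameBoundsOn.of_dense`). The
Gram integrals require `|λₙ| < 1`, equivalently `Re M(λₙ) > 0`; either observability property forces
this when tested on `φ n`. -/

theorem IsUnconditionalSeq.exists_norm_sum_mul_smul_le (hφ : IsUnconditionalSeq φ) :
    ∃ K : ℝ, 0 < K ∧ ∀ (M : ℝ) (d : ℕ → ℂ), 0 ≤ M → (∀ n, ‖d n‖ ≤ M) →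
      ∀ (s : Finset ℕ) (a : ℕ → ℂ),
        ‖∑ n ∈ s, (d n * a n) • φ n‖ ≤ K * M * ‖∑ n ∈ s, a n • φ n‖ := by
  obtain ⟨c₁, c₂, h₁, h₂, h⟩ := hφ
  -- The upper estimate is applied to the multiplied coefficients and the lower one to the original
  -- coefficients, whence the ratio.
  refine ⟨√(c₂ / c₁), by positivity, fun M d hM hd s a => ?_⟩
  refine le_of_sq_le_sq ?_ (by positivity)
  rw [mul_pow, mul_pow, Real.sq_sqrt (by positivity)]
  calc ‖∑ n ∈ s, (d n * a n) • φ n‖ ^ 2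
      ≤ c₂ * ∑ n ∈ s, ‖d n * a n‖ ^ 2 * ‖φ n‖ ^ 2 := (h s _).2
    _ ≤ c₂ * ∑ n ∈ s, M ^ 2 * (‖a n‖ ^ 2 * ‖φ n‖ ^ 2) := by
        gcongr ?_ * ∑ n ∈ s, ?_ with n
        rw [norm_mul, mul_pow, mul_assoc]
        gcongr
        exact hd n
    _ = c₂ / c₁ * M ^ 2 * (c₁ * ∑ n ∈ s, ‖a n‖ ^ 2 * ‖φ n‖ ^ 2) := by
        rw [← Finset.mul_sum]; field_simp
    _ ≤ _ := by gcongr; exact (h s a).1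

theorem mem_span_range_iff_exists_sum {x : X} :
    x ∈ Submodule.span ℂ (Set.range φ) ↔
      ∃ (s : Finset ℕ) (a : ℕ → ℂ), ∑ n ∈ s, a n • φ n = x := by
  constructor
  · intro hx
    obtain ⟨c, rfl⟩ := Finsupp.mem_span_range_iff_exists_finsupp.1 hx
    exact ⟨c.support, c, rfl⟩
  · rintro ⟨s, a, rfl⟩
    exact Submodule.sum_mem _ fun n _ =>
      Submodule.smul_mem _ _ (Submodule.subset_span ⟨n, rfl⟩)

theorem IsUnconditionalBasis.dense_span (hφ : IsUnconditionalBasis φ) :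
    Dense (Submodule.span ℂ (Set.range φ) : Set X) :=
  Submodule.dense_iff_topologicalClosure_eq_top.2 hφ.1

theorem IsUnconditionalBasis.eq_of_forall_inner_eq (hφ : IsUnconditionalBasis φ) {y z : X}
    (h : ∀ n, inner ℂ (φ n) y = inner ℂ (φ n) z) : y = z := by
  refine hφ.dense_span.eq_of_inner_right ℂ fun v hv => ?_
  obtain ⟨s, a, rfl⟩ := mem_span_range_iff_exists_sum.1 hv
  simp only [sum_inner, inner_smul_left, h]

variable [CompleteSpace X]

/-- The multiplier bound on finitely supported coefficients makes the diagonal map well defined and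
bounded on the dense span, so it extends continuously. -/
theorem IsUnconditionalBasis.exists_diagonal (hφ : IsUnconditionalBasis φ) {d : ℕ → ℂ} {M : ℝ}
    (hM : 0 ≤ M) (hd : ∀ n, ‖d n‖ ≤ M) : ∃ D : X →L[ℂ] X, ∀ n, D (φ n) = d n • φ n := by
  obtain ⟨K, -, h⟩ := hφ.2.exists_norm_sum_mul_smul_le
  let e : (ℕ →₀ ℂ) →ₗ[ℂ] X := Finsupp.linearCombination ℂ φ
  let f : (ℕ →₀ ℂ) →ₗ[ℂ] X := Finsupp.linearCombination ℂ fun n => d n • φ n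
  have he : DenseRange e := by
    have := hφ.dense_span
    rw [← Finsupp.range_linearCombination] at this
    simpa [DenseRange, e] using! this
  have hfe : ∀ a, ‖f a‖ ≤ K * M * ‖e a‖ := fun a => by
    have := h M d hM hd a.support a
    simpa [f, e, Finsupp.linearCombination_apply, Finsupp.sum, smul_smul, mul_comm (d _)] using this
  refine ⟨f.extendOfNorm e, fun n => ?_⟩
  have := LinearMap.extendOfNorm_eq he ⟨_, hfe⟩ (Finsupp.single n 1)
  simpa [f, e] using this

/-- A bounded operator that acts diagonally on an unconditional basis is invertible if its
eigenvalues are bounded away from zero. -/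
theorem IsUnconditionalBasis.isUnit_of_eigenvalues (hφ : IsUnconditionalBasis φ) {T : X →L[ℂ] X}
    {μ : ℕ → ℂ} (hT : ∀ n, T (φ n) = μ n • φ n) {ε : ℝ} (hε : 0 < ε) (hμ : ∀ n, ε ≤ ‖μ n‖) :
    IsUnit T := by
  have hμ0 : ∀ n, μ n ≠ 0 := fun n => norm_pos_iff.1 (hε.trans_le (hμ n))
  obtain ⟨D, hD⟩ := hφ.exists_diagonal (d := fun n => (μ n)⁻¹) (M := ε⁻¹) (by positivity)
    fun n => by rw [norm_inv]; exact inv_anti₀ hε (hμ n)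
  have key : ∀ S : X →L[ℂ] X, (∀ n, S (φ n) = φ n) → S = 1 := fun S hS =>
    ContinuousLinearMap.ext_on hφ.dense_span (by rintro _ ⟨n, rfl⟩; simp [hS])
  exact ⟨⟨T, D, key _ fun n => by simp [hD, hT, hμ0], key _ fun n => by simp [hD, hT, hμ0]⟩, rfl⟩

end Unconditional

section Eigenvectors

variable {X : Type*} [NormedAddCommGroup X] [InnerProductSpace ℂ X]

theorem ringInverse_apply_eigenvector {T : X →L[ℂ] X} (hT : IsUnit T) {v : X} {μ : ℂ}
    (hv : T v = μ • v) (hμ : μ ≠ 0) : Ring.inverse T v = μ⁻¹ • v := by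
  have h : Ring.inverse T (T v) = v := by
    rw [← mul_apply_eq_comp, Ring.inverse_mul_cancel T hT,
      one_apply_eq_self]
  rw [hv, map_smul] at h
  rw [eq_inv_smul_iff₀ hμ, h]

theorem pow_apply_eigenvector {T : X →L[ℂ] X} {v : X} {μ : ℂ} (hv : T v = μ • v) (k : ℕ) :
    (T ^ k) v = μ ^ k • v := by
  induction k with
  | zero => simp
  | succ k ih => rw [pow_succ', mul_apply_eq_comp, ih, map_smul, hv, smul_smul, pow_succ]

theorem exp_apply_eigenvector [CompleteSpace X] {T : X →L[ℂ] X} {v : X} {μ : ℂ}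
    (hv : T v = μ • v) : NormedSpace.exp T v = Complex.exp μ • v := by
  have h₁ := (ContinuousLinearMap.apply ℂ X v).hasSum
    (NormedSpace.exp_series_hasSum_exp' (𝕂 := ℂ) T)
  have h₂ := (NormedSpace.exp_series_hasSum_exp' (𝕂 := ℂ) μ).smul_const v
  rw [Complex.exp_eq_exp_ℂ]
  refine h₁.unique ?_
  convert! h₂ using 2 with k
  simp [pow_apply_eigenvector hv, smul_smul]

end Eigenvectors

theorem cayleyTransform_apply_eigenvector {X : Type*} [NormedAddCommGroup X]
    [InnerProductSpace ℂ X] {A : X →L[ℂ] X} (hA : IsUnit (1 - A)) {v : X} {l : ℂ}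
    (hv : A v = -l • v) (hl : 1 + l ≠ 0) : cayleyTransform A v = -cayleyM l • v := by
  have h1 : (1 - A) v = (1 + l) • v := by simp [hv, add_smul]
  simp only [cayleyTransform, cayleyMOp, sub_neg_eq_add, ← sub_eq_add_neg,
    neg_apply, mul_apply_eq_comp,
    ringInverse_apply_eigenvector hA h1 hl, map_smul, add_apply,
    one_apply_eq_self, hv, cayleyM]
  match_scalars
  field_simp
  ring

/-! ### Observation families and their two-sided bounds -/

section FrameBounds

open Filter Topology
open scoped ENNReal NNReal

variable {T T' X : Type*} [MeasurableSpace T] [MeasurableSpace T'] [NormedAddCommGroup X]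
  [InnerProductSpace ℂ X] {μ : Measure T} {μ' : Measure T'}

/-- The observations `t ↦ F t x` of the vectors `x ∈ S` have `L²`-norm comparable to `‖x‖`. -/
def FrameBoundsOn (μ : Measure T) (F : T → X →L[ℂ] ℂ) (S : Set X) : Prop :=
  ∃ c C : ℝ≥0, 0 < c ∧ ∀ x ∈ S,
    c * ‖x‖ₑ ≤ eLpNorm (fun t => F t x) 2 μ ∧ eLpNorm (fun t => F t x) 2 μ ≤ C * ‖x‖ₑ

theorem FrameBoundsOn.mono {F : T → X →L[ℂ] ℂ} {S S' : Set X} (h : FrameBoundsOn μ F S)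
    (hS : S' ⊆ S) : FrameBoundsOn μ F S' := by
  obtain ⟨c, C, hc, h⟩ := h
  exact ⟨c, C, hc, fun x hx => h x (hS hx)⟩

theorem FrameBoundsOn.memLp {F : T → X →L[ℂ] ℂ} {S : Set X} (h : FrameBoundsOn μ F S)
    (hF : ∀ x, AEStronglyMeasurable (fun t => F t x) μ) {x : X} (hx : x ∈ S) :
    MemLp (fun t => F t x) 2 μ := by
  obtain ⟨c, C, -, h⟩ := h
  exact ⟨hF x, (h x hx).2.trans_lt (ENNReal.mul_lt_top ENNReal.coe_lt_top enorm_lt_top)⟩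

/-- Used at `φ n` to exclude `⟨φ n, b⟩ = 0`; only then does square integrability constrain the
eigenvalue. -/
theorem FrameBoundsOn.exists_ne_zero {F : T → X →L[ℂ] ℂ} {S : Set X} (h : FrameBoundsOn μ F S)
    {x : X} (hx : x ∈ S) (hx0 : x ≠ 0) : ∃ t, F t x ≠ 0 := by
  obtain ⟨c, C, hc, h⟩ := h
  by_contra! h0
  have := (h x hx).1
  simp [h0, hc.ne', hx0] at this

/-- The upper bound passes to limits by Fatou. The lower bound then follows from the triangle
inequality, with the upper bound controlling the error `u n - x`. -/
theorem FrameBoundsOn.of_dense {F : T → X →L[ℂ] ℂ} {S : Set X} (h : FrameBoundsOn μ F S)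
    (hS : Dense S) (hF : ∀ x, AEStronglyMeasurable (fun t => F t x) μ) :
    FrameBoundsOn μ F Set.univ := by
  obtain ⟨c, C, hc, h⟩ := h
  have upper : ∀ x, eLpNorm (fun t => F t x) 2 μ ≤ C * ‖x‖ₑ := fun x => by
    obtain ⟨u, hu, hux⟩ := mem_closure_iff_seq_limit.1 (hS x)
    have h1 := Lp.eLpNorm_lim_le_liminf_eLpNorm (p := 2) (μ := μ) (f := fun n t => F t (u n))
      (fun n => hF _) (fun t => F t x)
      (Eventually.of_forall fun t => ((F t).continuous.tendsto x).comp hux)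
    have h2 : Tendsto (fun n => (C : ℝ≥0∞) * ‖u n‖ₑ) atTop (𝓝 (C * ‖x‖ₑ)) :=
      ENNReal.Tendsto.const_mul hux.enorm (Or.inr ENNReal.coe_ne_top)
    rw [← h2.liminf_eq]
    exact h1.trans (liminf_le_liminf (Eventually.of_forall fun n => (h _ (hu n)).2))
  refine ⟨c, C, hc, fun x _ => ⟨?_, upper x⟩⟩
  obtain ⟨u, hu, hux⟩ := mem_closure_iff_seq_limit.1 (hS x)
  have h1 : ∀ n, (c : ℝ≥0∞) * ‖u n‖ₑ ≤ eLpNorm (fun t => F t x) 2 μ + C * ‖u n - x‖ₑ := fun n =>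
    calc (c : ℝ≥0∞) * ‖u n‖ₑ ≤ eLpNorm (fun t => F t (u n)) 2 μ := (h _ (hu n)).1
      _ = eLpNorm ((fun t => F t x) + fun t => F t (u n - x)) 2 μ := by
        congr 1; ext t; simp
      _ ≤ _ := (eLpNorm_add_le (hF _) (hF _) (by norm_num)).trans (by gcongr; exact upper _)
  have h2 : Tendsto (fun n => (c : ℝ≥0∞) * ‖u n‖ₑ) atTop (𝓝 (c * ‖x‖ₑ)) :=
    ENNReal.Tendsto.const_mul hux.enorm (Or.inr ENNReal.coe_ne_top)
  have h3 : Tendsto (fun n => eLpNorm (fun t => F t x) 2 μ + C * ‖u n - x‖ₑ) atTop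
      (𝓝 (eLpNorm (fun t => F t x) 2 μ + C * ‖x - x‖ₑ)) :=
    tendsto_const_nhds.add
      (ENNReal.Tendsto.const_mul (hux.sub_const x).enorm (Or.inr ENNReal.coe_ne_top))
  simpa using le_of_tendsto_of_tendsto' h2 h3 h1

/-- Transport of two-sided bounds along a unimodular diagonal change of coefficients. -/
theorem FrameBoundsOn.span_of_eLpNorm_eq {φ : ℕ → X} (hφ : IsUnconditionalSeq φ)
    {F : T → X →L[ℂ] ℂ} {G : T' → X →L[ℂ] ℂ} {u : ℕ → ℂ} (hu : ∀ n, ‖u n‖ = 1)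
    (hFG : ∀ (s : Finset ℕ) (a : ℕ → ℂ), eLpNorm (fun t => G t (∑ n ∈ s, a n • φ n)) 2 μ' =
      eLpNorm (fun t => F t (∑ n ∈ s, (u n * a n) • φ n)) 2 μ)
    (h : FrameBoundsOn μ F (Submodule.span ℂ (Set.range φ))) :
    FrameBoundsOn μ' G (Submodule.span ℂ (Set.range φ)) := by
  obtain ⟨K, hK, hKφ⟩ := hφ.exists_norm_sum_mul_smul_le
  obtain ⟨c, C, hc, h⟩ := h
  lift K to ℝ≥0 using hK.le
  have hK' : 0 < K := by exact_mod_cast hK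
  have hu0 : ∀ n, u n ≠ 0 := fun n => norm_pos_iff.1 (by simp [hu])
  refine ⟨c / K, C * K, by positivity, fun x hx => ?_⟩
  obtain ⟨s, a, rfl⟩ := mem_span_range_iff_exists_sum.1 hx
  obtain ⟨h1, h2⟩ := h _ (mem_span_range_iff_exists_sum.2 ⟨s, fun n => u n * a n, rfl⟩)
  have e1 := hKφ 1 u zero_le_one (fun n => (hu n).le) s a
  -- Multiplying by the inverse factors, also unimodular, gives the reverse comparison that the
  -- lower bound needs.
  have e2 := hKφ 1 (fun n => (u n)⁻¹) zero_le_one (fun n => by simp [hu]) s (fun n => u n * a n)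
  simp only [inv_mul_cancel_left₀ (hu0 _), mul_one] at e1 e2
  have e1' : ‖∑ n ∈ s, (u n * a n) • φ n‖ₑ ≤ K * ‖∑ n ∈ s, a n • φ n‖ₑ := by
    simp only [enorm_eq_nnnorm]; exact_mod_cast e1
  have e2' : ‖∑ n ∈ s, a n • φ n‖ₑ ≤ K * ‖∑ n ∈ s, (u n * a n) • φ n‖ₑ := by
    simp only [enorm_eq_nnnorm]; exact_mod_cast e2
  rw [hFG]
  constructor
  · refine le_trans ?_ h1
    calc ((c / K : ℝ≥0) : ℝ≥0∞) * ‖∑ n ∈ s, a n • φ n‖ₑ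
        ≤ ((c / K : ℝ≥0) : ℝ≥0∞) * (K * ‖∑ n ∈ s, (u n * a n) • φ n‖ₑ) := by gcongr
      _ = c * ‖∑ n ∈ s, (u n * a n) • φ n‖ₑ := by
        rw [← mul_assoc, ← ENNReal.coe_mul, div_mul_cancel₀ _ hK'.ne']
  · refine h2.trans ?_
    rw [ENNReal.coe_mul, mul_assoc]
    gcongr

end FrameBounds

/-! ### Gram matrices -/

theorem norm_sum_smul_eq_of_inner_eq {H H' : Type*} [NormedAddCommGroup H] [InnerProductSpace ℂ H]
    [NormedAddCommGroup H'] [InnerProductSpace ℂ H'] {f : ℕ → H} {g : ℕ → H'}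
    (h : ∀ n m, inner ℂ (f n) (f m) = inner ℂ (g n) (g m)) (s : Finset ℕ) (a : ℕ → ℂ) :
    ‖∑ n ∈ s, a n • f n‖ = ‖∑ n ∈ s, a n • g n‖ := by
  rw [← sq_eq_sq₀ (norm_nonneg _) (norm_nonneg _), ← @inner_self_eq_norm_sq ℂ,
    ← @inner_self_eq_norm_sq ℂ]
  simp only [sum_inner, inner_sum, inner_smul_left, inner_smul_right, h]

theorem eLpNorm_sum_mul_eq_enorm_sum_toLp {T : Type*} [MeasurableSpace T] {μ : Measure T}
    {f : ℕ → T → ℂ} (hf : ∀ n, MemLp (f n) 2 μ) (s : Finset ℕ) (a : ℕ → ℂ) :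
    eLpNorm (fun t => ∑ n ∈ s, a n * f n t) 2 μ = ‖∑ n ∈ s, a n • (hf n).toLp (f n)‖ₑ := by
  rw [Lp.enorm_def]
  refine eLpNorm_congr_ae ?_
  have h1 : ∀ᵐ t ∂μ, ∀ n, (hf n).toLp (f n) t = f n t :=
    ae_all_iff.2 fun n => (hf n).coeFn_toLp
  have h2 : ∀ᵐ t ∂μ, ∀ n, (a n • (hf n).toLp (f n)) t = (a n • ⇑((hf n).toLp (f n))) t :=
    ae_all_iff.2 fun n => Lp.coeFn_smul _ _
  filter_upwards [h1, h2, Lp.coeFn_fun_finsetSum s fun n => a n • (hf n).toLp (f n)]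
    with t h1 h2 h3
  rw [h3]
  exact Finset.sum_congr rfl fun n _ => by simp [h2, h1]

theorem inner_toLp_eq_integral {T : Type*} [MeasurableSpace T] {μ : Measure T} {f g : T → ℂ}
    (hf : MemLp f 2 μ) (hg : MemLp g 2 μ) :
    inner ℂ (hf.toLp f) (hg.toLp g) = ∫ t, star (f t) * g t ∂μ := by
  rw [L2.inner_def]
  refine integral_congr_ae ?_
  filter_upwards [hf.coeFn_toLp, hg.coeFn_toLp] with t hf hg
  simp [hf, hg, mul_comm]

theorem eLpNorm_sum_mul_eq_of_integral_eq {T T' : Type*} [MeasurableSpace T] [MeasurableSpace T']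
    {μ : Measure T} {μ' : Measure T'} {f : ℕ → T → ℂ} {g : ℕ → T' → ℂ}
    (hf : ∀ n, MemLp (f n) 2 μ) (hg : ∀ n, MemLp (g n) 2 μ')
    (h : ∀ n m, ∫ t, star (f n t) * f m t ∂μ = ∫ t, star (g n t) * g m t ∂μ')
    (s : Finset ℕ) (a : ℕ → ℂ) :
    eLpNorm (fun t => ∑ n ∈ s, a n * f n t) 2 μ = eLpNorm (fun t => ∑ n ∈ s, a n * g n t) 2 μ' := by
  rw [eLpNorm_sum_mul_eq_enorm_sum_toLp hf, eLpNorm_sum_mul_eq_enorm_sum_toLp hg, ← ofReal_norm,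
    ← ofReal_norm, norm_sum_smul_eq_of_inner_eq (g := fun n => (hg n).toLp (g n)) fun n m => ?_]
  rw [inner_toLp_eq_integral, inner_toLp_eq_integral, h]

/-! ### Exact observability as two-sided bounds -/

section EOB

open scoped ENNReal NNReal

/-- Treating `ℓ²` as `L²` of counting measure puts both kinds of observability under
`FrameBoundsOn`. -/
theorem enorm_lp_eq_eLpNorm_count (f : lp (fun _ : ℕ => ℂ) 2) :
    ‖f‖ₑ = eLpNorm f 2 (Measure.count : Measure ℕ) := by
  have hs : Summable fun k => ‖f k‖ ^ (2 : ℝ) := by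
    simpa using (memℓp_gen_iff (p := 2) (by simp)).1 (lp.memℓp f)
  rw [eLpNorm_eq_lintegral_rpow_enorm_toReal (by simp) (by simp), lintegral_count, ← ofReal_norm,
    lp.norm_eq_tsum_rpow (by simp)]
  have h2 : (2 : ℝ≥0∞).toReal = 2 := by simp
  rw [h2, ← ENNReal.ofReal_rpow_of_nonneg (tsum_nonneg fun _ => by positivity) (by positivity),
    ENNReal.ofReal_tsum_of_nonneg (fun _ => by positivity) hs]
  simp_rw [← ENNReal.ofReal_rpow_of_nonneg (norm_nonneg _) zero_le_two, ofReal_norm]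

theorem memℓp_two_of_memLp_count {f : ℕ → ℂ} (hf : MemLp f 2 (Measure.count : Measure ℕ)) :
    Memℓp f 2 := by
  have := (memLp_two_iff_integrable_sq_norm hf.1).1 hf
  rw [integrable_count_iff] at this
  refine memℓp_gen ?_
  simpa using this

variable {X : Type*} [NormedAddCommGroup X] [InnerProductSpace ℂ X]

theorem exists_bddBelow_iff_enorm {E : Type*} [NormedAddCommGroup E] [NormedSpace ℂ E]
    (Ψ : X →L[ℂ] E) : (∃ c : ℝ, 0 < c ∧ ∀ x, c * ‖x‖ ≤ ‖Ψ x‖) ↔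
      ∃ c C : ℝ≥0, 0 < c ∧ ∀ x, c * ‖x‖ₑ ≤ ‖Ψ x‖ₑ ∧ ‖Ψ x‖ₑ ≤ C * ‖x‖ₑ := by
  constructor
  · rintro ⟨c, hc, h⟩
    lift c to ℝ≥0 using hc.le
    refine ⟨c, ‖Ψ‖₊, by exact_mod_cast hc, fun x => ⟨?_, Ψ.le_opENorm x⟩⟩
    simp only [enorm_eq_nnnorm]; exact_mod_cast h x
  · rintro ⟨c, C, hc, h⟩
    refine ⟨c, by exact_mod_cast hc, fun x => ?_⟩
    have := (h x).1
    simp only [enorm_eq_nnnorm] at this; exact_mod_cast this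

theorem FrameBoundsOn.exists_clm {T : Type*} [MeasurableSpace T] {μ : Measure T}
    {F : T → X →L[ℂ] ℂ} (h : FrameBoundsOn μ F Set.univ)
    {E : Type*} [NormedAddCommGroup E] [NormedSpace ℂ E] (Ψ : X →ₗ[ℂ] E)
    (hΨ : ∀ x, ‖Ψ x‖ₑ = eLpNorm (fun t => F t x) 2 μ) :
    ∃ Ψ' : X →L[ℂ] E, (∀ x, Ψ' x = Ψ x) ∧ ∃ c : ℝ, 0 < c ∧ ∀ x, c * ‖x‖ ≤ ‖Ψ' x‖ := by
  obtain ⟨c, C, hc, h⟩ := h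
  refine ⟨Ψ.mkContinuous C fun x => ?_, fun x => rfl, ?_⟩
  · have := (h x trivial).2
    rw [← hΨ] at this
    simp only [enorm_eq_nnnorm] at this
    exact_mod_cast this
  · rw [exists_bddBelow_iff_enorm]
    refine ⟨c, C, hc, fun x => ?_⟩
    change c * ‖x‖ₑ ≤ ‖Ψ x‖ₑ ∧ ‖Ψ x‖ₑ ≤ C * ‖x‖ₑ
    rw [hΨ]
    exact h x (Set.mem_univ x)

theorem discreteEOB_iff_frameBoundsOn (A : X →L[ℂ] X) (B : X →L[ℂ] ℂ) :
    DiscreteEOB A B ↔ FrameBoundsOn (Measure.count : Measure ℕ) (fun k => B ∘L A ^ k) Set.univ := by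
  constructor
  · rintro ⟨Ψ, hΨ, h⟩
    obtain ⟨c, C, hc, h⟩ := (exists_bddBelow_iff_enorm Ψ).1 h
    refine ⟨c, C, hc, fun x _ => ?_⟩
    have := h x
    rw [enorm_lp_eq_eLpNorm_count] at this
    simpa only [ContinuousLinearMap.comp_apply, ← hΨ] using this
  · intro h
    have hF : ∀ x : X, AEStronglyMeasurable (fun k => (B ∘L A ^ k) x)
        (Measure.count : Measure ℕ) := fun x => by fun_prop
    have hm : ∀ x : X, Memℓp (fun k => (B ∘L A ^ k) x) 2 := fun x =>
      memℓp_two_of_memLp_count (h.memLp hF trivial)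
    let Ψ : X →ₗ[ℂ] lp (fun _ : ℕ => ℂ) 2 :=
      { toFun := fun x => ⟨fun k => (B ∘L A ^ k) x, hm x⟩
        map_add' := fun x y => by ext k; exact map_add (B ∘L A ^ k) x y
        map_smul' := fun a x => by ext k; exact map_smul (B ∘L A ^ k) a x }
    obtain ⟨Ψ', h1, h2⟩ := h.exists_clm Ψ fun x => enorm_lp_eq_eLpNorm_count _
    exact ⟨Ψ', fun x k => by rw [h1]; rfl, h2⟩

theorem continuous_exp_smul [CompleteSpace X] (A : X →L[ℂ] X) :
    Continuous fun t : ℝ => NormedSpace.exp ((t : ℂ) • A) := by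
  let _ : NormedAlgebra ℚ (X →L[ℂ] X) := NormedAlgebra.restrictScalars ℚ ℂ _
  exact NormedSpace.exp_continuous.comp (by fun_prop)

theorem continuousEOB_iff_frameBoundsOn [CompleteSpace X] (A : X →L[ℂ] X) (B : X →L[ℂ] ℂ) :
    ContinuousEOB A B ↔ FrameBoundsOn ((volume : Measure ℝ).restrict (Set.Ici 0))
      (fun t => B ∘L NormedSpace.exp ((t : ℂ) • A)) Set.univ := by
  constructor
  · rintro ⟨Ψ, hΨ, h⟩
    obtain ⟨c, C, hc, h⟩ := (exists_bddBelow_iff_enorm Ψ).1 h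
    refine ⟨c, C, hc, fun x _ => ?_⟩
    have := h x
    rwa [Lp.enorm_def, eLpNorm_congr_ae (hΨ x)] at this
  · intro h
    have hF : ∀ x : X, AEStronglyMeasurable (fun t : ℝ => (B ∘L NormedSpace.exp ((t : ℂ) • A)) x)
        ((volume : Measure ℝ).restrict (Set.Ici 0)) := fun x => by
      refine Continuous.aestronglyMeasurable ?_
      exact B.continuous.comp ((continuous_exp_smul A).clm_apply continuous_const)
    have hm := fun x : X => h.memLp hF (Set.mem_univ x)
    let Ψ : X →ₗ[ℂ] Lp ℂ 2 ((volume : Measure ℝ).restrict (Set.Ici 0)) :=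
      { toFun := fun x => (hm x).toLp _
        map_add' := fun x y => by
          rw [← MemLp.toLp_add]; congr 1; ext t; simp
        map_smul' := fun a x => by
          rw [RingHom.id_apply, ← MemLp.toLp_const_smul]; congr 1; ext t; simp }
    obtain ⟨Ψ', h1, h2⟩ := h.exists_clm Ψ fun x => by
      rw [Lp.enorm_def]; exact eLpNorm_congr_ae (hm x).coeFn_toLp
    exact ⟨Ψ', fun x => by rw [h1]; exact (hm x).coeFn_toLp, h2⟩

end EOB

/-! ### Geometric and exponential sequences -/

theorem norm_lt_one_of_memLp_pow {β l : ℂ} (hβ : β ≠ 0)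
    (h : MemLp (fun k => l ^ k * β) 2 (Measure.count : Measure ℕ)) : ‖l‖ < 1 := by
  have h1 := (memLp_two_iff_integrable_sq_norm h.1).1 h
  rw [integrable_count_iff] at h1
  have h2 : Summable fun k : ℕ => (‖l‖ ^ 2) ^ k := by
    refine (summable_mul_right_iff (a := ‖β‖ ^ 2) (by positivity)).1 (h1.congr fun k => ?_)
    simp [mul_pow, ← pow_mul, mul_comm]
  rw [summable_geometric_iff_norm_lt_one, Real.norm_of_nonneg (by positivity)] at h2
  nlinarith [norm_nonneg l]

theorem memLp_pow {l : ℂ} (β : ℂ) (hl : ‖l‖ < 1) :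
    MemLp (fun k => l ^ k * β) 2 (Measure.count : Measure ℕ) := by
  rw [memLp_two_iff_integrable_sq_norm (by fun_prop), integrable_count_iff]
  have := (summable_geometric_of_lt_one (r := ‖l‖ ^ 2) (by positivity)
    (by nlinarith [norm_nonneg l])).mul_right (‖β‖ ^ 2)
  refine this.congr fun k => ?_
  simp [mul_pow, ← pow_mul, mul_comm]

theorem integral_star_pow_mul_pow {l l' : ℂ} (β β' : ℂ) (hl : ‖l‖ < 1) (hl' : ‖l'‖ < 1) :
    ∫ k, star (l ^ k * β) * (l' ^ k * β') ∂(Measure.count : Measure ℕ) =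
      star β * β' / (1 - star l * l') := by
  have hr : ‖star l * l'‖ < 1 := by
    rw [norm_mul, norm_star]; nlinarith [norm_nonneg l, norm_nonneg l']
  have he : (fun k : ℕ => star (l ^ k * β) * (l' ^ k * β')) =
      fun k => (star l * l') ^ k * (star β * β') := by
    ext k; simp only [star_mul, star_pow]; ring
  rw [he, integral_countable]
  · simp only [Measure.real, Measure.count_singleton, ENNReal.toReal_one, one_smul, tsum_mul_right,
      tsum_geometric_of_norm_lt_one hr, div_eq_inv_mul]
  · rw [integrable_count_iff]
    simp_rw [norm_mul _ (star β * β'), norm_pow]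
    exact (summable_geometric_of_lt_one (norm_nonneg _) hr).mul_right _

/-- If `0 ≤ m.re`, the squared modulus dominates the nonzero constant `‖β‖ ^ 2`, which is not
integrable on a half-line. -/
theorem re_neg_of_memLp_exp {β m : ℂ} (hβ : β ≠ 0)
    (h : MemLp (fun t : ℝ => Complex.exp (m * t) * β) 2
      ((volume : Measure ℝ).restrict (Set.Ici 0))) : m.re < 0 := by
  by_contra! hm
  have h1 := (memLp_two_iff_integrable_sq_norm h.1).1 h
  have h2 : Integrable (fun _ : ℝ => ‖β‖ ^ 2) ((volume : Measure ℝ).restrict (Set.Ici 0)) := by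
    refine h1.mono' (by fun_prop) ?_
    filter_upwards [ae_restrict_mem measurableSet_Ici] with t ht
    rw [norm_mul, mul_pow, Complex.norm_exp, Real.norm_of_nonneg (by positivity)]
    refine le_mul_of_one_le_left (by positivity) (one_le_pow₀ (Real.one_le_exp ?_))
    simpa using mul_nonneg hm ht
  rw [integrable_const_iff] at h2
  rcases h2 with h2 | h2
  · simp [hβ] at h2
  · have := h2.measure_univ_lt_top
    simp at this

theorem memLp_exp {m : ℂ} (β : ℂ) (hm : m.re < 0) :
    MemLp (fun t : ℝ => Complex.exp (m * t) * β) 2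
      ((volume : Measure ℝ).restrict (Set.Ici 0)) := by
  rw [memLp_two_iff_integrable_sq_norm (Continuous.aestronglyMeasurable (by fun_prop))]
  have h : IntegrableOn (fun t : ℝ => Real.exp (2 * m.re * t)) (Set.Ici 0) :=
    Iff.mpr integrableOn_Ici_iff_integrableOn_Ioi (integrableOn_exp_mul_Ioi (by linarith) 0)
  refine (h.mul_const (‖β‖ ^ 2)).congr (Filter.Eventually.of_forall fun t => ?_)
  simp only [norm_mul, mul_pow, Complex.norm_exp, ← Real.exp_nat_mul]
  congr 2
  simp
  ring

theorem integral_star_exp_mul_exp {m m' : ℂ} (β β' : ℂ) (hm : m.re < 0) (hm' : m'.re < 0) :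
    ∫ t, star (Complex.exp (m * (t : ℝ)) * β) * (Complex.exp (m' * (t : ℝ)) * β')
      ∂((volume : Measure ℝ).restrict (Set.Ici 0)) = -(star β * β') / (star m + m') := by
  have he : (fun t : ℝ => star (Complex.exp (m * t) * β) * (Complex.exp (m' * t) * β')) =
      fun t : ℝ => Complex.exp ((star m + m') * t) * (star β * β') := by
    ext t
    simp only [star_mul, add_mul, Complex.exp_add, Complex.star_def, ← Complex.exp_conj, map_mul,
      Complex.conj_ofReal]
    ring
  rw [he, integral_Ici_eq_integral_Ioi, integral_mul_const, integral_exp_mul_complex_Ioi]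
  · simp; ring
  · simp; linarith

/-- `Re M(l) = (1 - |l|²) / |1 + l|²`. -/
theorem cayleyM_re_pos_iff {l : ℂ} (hl : 1 + l ≠ 0) : 0 < (cayleyM l).re ↔ ‖l‖ < 1 := by
  have h0 : 0 < Complex.normSq (1 + l) := Complex.normSq_pos.2 hl
  have : (cayleyM l).re = (1 - Complex.normSq l) / Complex.normSq (1 + l) := by
    rw [cayleyM, Complex.div_re, ← add_div]
    congr 1
    simp [Complex.normSq_apply]
    ring
  rw [this, div_pos_iff_of_pos_right h0, Complex.normSq_eq_norm_sq, sub_pos,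
    sq_lt_one_iff₀ (norm_nonneg _)]

/-- The identity behind the theorem: up to unimodular factors, the Gram matrices of the
exponentials with exponents `-M(lₙ)` and of the geometric sequences with ratios `-lₙ` agree. -/
theorem gram_cayleyM_eq {l l' : ℂ} (β β' : ℂ) (hl : ‖l‖ < 1) (hl' : ‖l'‖ < 1)
    (h0 : 1 + l ≠ 0) (h0' : 1 + l' ≠ 0) :
    -(star (((√2 / ‖1 + l‖ : ℝ) : ℂ) * β) * (((√2 / ‖1 + l'‖ : ℝ) : ℂ) * β')) /
        (star (-cayleyM l) + -cayleyM l') =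
      star ((1 + l) / ‖1 + l‖ * β) * ((1 + l') / ‖1 + l'‖ * β') / (1 - star (-l) * -l') := by
  have hs : (1 : ℂ) + star l ≠ 0 := by
    rw [← star_one, ← star_add]; exact star_ne_zero.2 h0
  have hr : 1 - star l * l' ≠ 0 := by
    intro h
    have h1 : ‖star l * l'‖ < 1 := by
      rw [norm_mul, norm_star]; nlinarith [norm_nonneg l, norm_nonneg l']
    rw [← sub_eq_zero.1 h, norm_one] at h1
    exact lt_irrefl _ h1
  have hn : ((‖1 + l‖ : ℝ) : ℂ) ≠ 0 := by simpa using h0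
  have hn' : ((‖1 + l'‖ : ℝ) : ℂ) ≠ 0 := by simpa using h0'
  have h2 : ((√2 : ℝ) : ℂ) * ((√2 : ℝ) : ℂ) = 2 := by
    rw [← Complex.ofReal_mul, Real.mul_self_sqrt zero_le_two]; norm_num
  have hden : star (-cayleyM l) + -cayleyM l' =
      -(2 * (1 - star l * l') / ((1 + star l) * (1 + l'))) := by
    simp only [cayleyM, star_neg, star_div₀, star_sub, star_add, star_one]
    field_simp
    ring
  rw [hden]
  simp only [star_neg, neg_mul_neg, star_mul, star_div₀, star_add, star_one, Complex.ofReal_div,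
    Complex.star_def, Complex.conj_ofReal]
  simp only [Complex.star_def] at hs hr
  rw [mul_comm (starRingEnd ℂ l)] at hr ⊢
  field_simp
  -- The two weights `√2` cancel the factor 2 of the denominator.
  linear_combination (starRingEnd ℂ β * β') * h2

/-! ### The main theorem -/

section Main

variable {X : Type*} [NormedAddCommGroup X] [InnerProductSpace ℂ X]

theorem discrete_observation_eigenvector {A : X →L[ℂ] X} {v : X} {l : ℂ} (hv : A v = -l • v)
    (b : X) (k : ℕ) : (analysisOp b ∘L A ^ k) v = (-l) ^ k * inner ℂ b v := by
  simp only [ContinuousLinearMap.comp_apply, pow_apply_eigenvector hv, analysisOp,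
    innerSL_apply_apply, inner_smul_right]

theorem continuous_observation_eigenvector [CompleteSpace X] {A : X →L[ℂ] X} {v : X} {m : ℂ}
    (hv : A v = m • v) (b : X) (t : ℝ) :
    (analysisOp b ∘L NormedSpace.exp ((t : ℂ) • A)) v = Complex.exp (m * t) * inner ℂ b v := by
  have h : ((t : ℂ) • A) v = (m * t) • v := by
    rw [smul_apply, hv, smul_smul, mul_comm]
  simp only [ContinuousLinearMap.comp_apply, exp_apply_eigenvector h, analysisOp,
    innerSL_apply_apply, inner_smul_right]

/-- The equivalence on the span of the eigenvectors, given that all eigenvalues lie in the disc. -/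
theorem eLpNorm_continuous_observation_eq_discrete [CompleteSpace X] {A A' : X →L[ℂ] X}
    {φ : ℕ → X} {lam : ℕ → ℂ} {b b' : X} (hA : ∀ n, A (φ n) = -(lam n) • φ n)
    (hA' : ∀ n, A' (φ n) = -(cayleyM (lam n)) • φ n) (h0 : ∀ n, 1 + lam n ≠ 0)
    (hb : ∀ n, inner ℂ b' (φ n) = ((√2 / ‖1 + lam n‖ : ℝ) : ℂ) * inner ℂ b (φ n))
    (hlam : ∀ n, ‖lam n‖ < 1) (s : Finset ℕ) (a : ℕ → ℂ) :
    eLpNorm (fun t : ℝ => (analysisOp b' ∘L NormedSpace.exp ((t : ℂ) • A')) (∑ n ∈ s, a n • φ n)) 2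
        ((volume : Measure ℝ).restrict (Set.Ici 0)) =
      eLpNorm (fun k => (analysisOp b ∘L A ^ k)
        (∑ n ∈ s, ((1 + lam n) / ‖1 + lam n‖ * a n) • φ n)) 2 (Measure.count : Measure ℕ) := by
  have hre : ∀ n, (-cayleyM (lam n)).re < 0 := fun n => by
    simpa using (cayleyM_re_pos_iff (h0 n)).2 (hlam n)
  have hlam' : ∀ n, ‖-lam n‖ < 1 := fun n => by simpa using hlam n
  have key := eLpNorm_sum_mul_eq_of_integral_eq
    (f := fun n (t : ℝ) => Complex.exp (-cayleyM (lam n) * t) *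
      (((√2 / ‖1 + lam n‖ : ℝ) : ℂ) * inner ℂ b (φ n)))
    (g := fun n k => (-lam n) ^ k * ((1 + lam n) / ‖1 + lam n‖ * inner ℂ b (φ n)))
    (fun n => memLp_exp _ (hre n)) (fun n => memLp_pow _ (hlam' n))
    (fun n m => by
      rw [integral_star_exp_mul_exp _ _ (hre n) (hre m),
        integral_star_pow_mul_pow _ _ (hlam' n) (hlam' m)]
      exact gram_cayleyM_eq _ _ (hlam n) (hlam m) (h0 n) (h0 m)) s a
  convert! key using 2
  · ext t
    rw [map_sum]
    refine Finset.sum_congr rfl fun n _ => ?_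
    rw [map_smul, continuous_observation_eigenvector (hA' n), hb, smul_eq_mul]
  · ext k
    rw [map_sum]
    refine Finset.sum_congr rfl fun n _ => ?_
    rw [map_smul, discrete_observation_eigenvector (hA n), smul_eq_mul]
    ring

theorem discreteEOB_iff_continuousEOB [CompleteSpace X] {A A' : X →L[ℂ] X}
    {φ : ℕ → X} (hφ : IsUnconditionalBasis φ) (hφ0 : ∀ n, φ n ≠ 0) {lam : ℕ → ℂ} {b b' : X}
    (hA : ∀ n, A (φ n) = -(lam n) • φ n)
    (hA' : ∀ n, A' (φ n) = -(cayleyM (lam n)) • φ n) (h0 : ∀ n, 1 + lam n ≠ 0)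
    (hb : ∀ n, inner ℂ b' (φ n) = ((√2 / ‖1 + lam n‖ : ℝ) : ℂ) * inner ℂ b (φ n)) :
    DiscreteEOB A (analysisOp b) ↔ ContinuousEOB A' (analysisOp b') := by
  rw [discreteEOB_iff_frameBoundsOn, continuousEOB_iff_frameBoundsOn]
  set u : ℕ → ℂ := fun n => (1 + lam n) / ‖1 + lam n‖
  have hu : ∀ n, ‖u n‖ = 1 := fun n => by simp [u, h0 n]
  have hu0 : ∀ n, u n ≠ 0 := fun n => norm_pos_iff.1 (by simp [hu])
  have hm : ∀ x : X, AEStronglyMeasurable (fun k => (analysisOp b ∘L A ^ k) x)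
      (Measure.count : Measure ℕ) := fun x => by fun_prop
  have hm' : ∀ x : X, AEStronglyMeasurable
      (fun t : ℝ => (analysisOp b' ∘L NormedSpace.exp ((t : ℂ) • A')) x)
      ((volume : Measure ℝ).restrict (Set.Ici 0)) := fun x =>
    ((analysisOp b').continuous.comp
      ((continuous_exp_smul A').clm_apply continuous_const)).aestronglyMeasurable
  constructor
  · intro h
    have hlam : ∀ n, ‖lam n‖ < 1 := fun n => by
      obtain ⟨k, hk⟩ := h.exists_ne_zero (Set.mem_univ (φ n)) (hφ0 n)
      have h2 := h.memLp hm (Set.mem_univ (φ n))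
      simp only [discrete_observation_eigenvector (hA n)] at hk h2
      simpa using norm_lt_one_of_memLp_pow (right_ne_zero_of_mul hk) h2
    refine ((h.mono (Set.subset_univ _)).span_of_eLpNorm_eq hφ.2 hu fun s a => ?_).of_dense
      hφ.dense_span hm'
    exact eLpNorm_continuous_observation_eq_discrete hA hA' h0 hb hlam s a
  · intro h
    have hlam : ∀ n, ‖lam n‖ < 1 := fun n => by
      obtain ⟨t, ht⟩ := h.exists_ne_zero (Set.mem_univ (φ n)) (hφ0 n)
      have h2 := h.memLp hm' (Set.mem_univ (φ n))
      simp only [continuous_observation_eigenvector (hA' n)] at ht h2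
      rw [← cayleyM_re_pos_iff (h0 n)]
      simpa using re_neg_of_memLp_exp (right_ne_zero_of_mul ht) h2
    refine ((h.mono (Set.subset_univ _)).span_of_eLpNorm_eq (u := fun n => (u n)⁻¹) hφ.2
      (fun n => by simp [hu]) fun s a => ?_).of_dense hφ.dense_span hm
    -- Applied to the coefficients `(u n)⁻¹ * a n`, the norm identity restores `a n` on the discrete
    -- side.
    rw [eLpNorm_continuous_observation_eq_discrete hA hA' h0 hb hlam s]
    congr! 5 with k n
    exact (mul_inv_cancel_left₀ (hu0 n) (a n)).symm

/-- The vector is `D* b` for the diagonal operator `D` with entries `conj (r n)`; uniqueness is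
density of the span. -/
theorem IsUnconditionalBasis.existsUnique_inner_eq_mul [CompleteSpace X] {φ : ℕ → X}
    (hφ : IsUnconditionalBasis φ) {r : ℕ → ℂ} {M : ℝ} (hM : 0 ≤ M) (hr : ∀ n, ‖r n‖ ≤ M) (b : X) :
    ∃! b' : X, ∀ n, inner ℂ (φ n) b' = r n * inner ℂ (φ n) b := by
  obtain ⟨D, hD⟩ := hφ.exists_diagonal (d := fun n => star (r n)) hM (by simpa using hr)
  refine ⟨ContinuousLinearMap.adjoint D b, fun n => ?_, fun y hy =>
    hφ.eq_of_forall_inner_eq fun n => ?_⟩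
  · simp [ContinuousLinearMap.adjoint_inner_right, hD, inner_smul_left]
  · simp [hy, ContinuousLinearMap.adjoint_inner_right, hD, inner_smul_left]

end Main

theorem mainTheorem8 {X : Type*} [NormedAddCommGroup X] [InnerProductSpace ℂ X] [CompleteSpace X]
    (A : X →L[ℂ] X) (φ : ℕ → X) (lam : ℕ → ℂ)
    (hφ : IsUnconditionalBasis φ) (hφ0 : ∀ n, φ n ≠ 0)
    (hA : ∀ n, A (φ n) = -(lam n) • φ n)
    (ε : ℝ) (hε : 0 < ε) (hlam : ∀ n, ε < ‖lam n + 1‖)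
    (b : X) :
    -- the transformed operator is well defined and has the eigenvalues `-M(λₙ)`
    IsUnit (1 - A) ∧
    (∀ n, cayleyTransform A (φ n) = -(cayleyM (lam n)) • φ n) ∧
    -- the transformed vector exists and is unique
    (∃! b' : X, ∀ n,
      inner ℂ (φ n) b' = ((Real.sqrt 2 / ‖1 + lam n‖ : ℝ) : ℂ) * inner ℂ (φ n) b) ∧
    -- the equivalence
    (∀ b' : X,
      (∀ n, inner ℂ (φ n) b' = ((Real.sqrt 2 / ‖1 + lam n‖ : ℝ) : ℂ) * inner ℂ (φ n) b) →
      (DiscreteEOB A (analysisOp b) ↔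
        ContinuousEOB (cayleyTransform A) (analysisOp b'))) := by
  have h0 : ∀ n, 1 + lam n ≠ 0 := fun n h => by
    have := hlam n
    rw [add_comm, h, norm_zero] at this
    linarith
  have hU : IsUnit (1 - A) :=
    hφ.isUnit_of_eigenvalues (μ := fun n => lam n + 1)
      (fun n => by simp [hA, add_smul, add_comm]) hε fun n => (hlam n).le
  have hA' := fun n => cayleyTransform_apply_eigenvector hU (hA n) (h0 n)
  refine ⟨hU, hA', ?_, fun b' hb' => ?_⟩
  · refine hφ.existsUnique_inner_eq_mul (M := √2 / ε) (by positivity) (fun n => ?_) b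
    rw [Complex.norm_real, Real.norm_of_nonneg (by positivity), add_comm]
    gcongr
    exact (hlam n).le
  · refine discreteEOB_iff_continuousEOB hφ hφ0 hA hA' h0 fun n => ?_
    -- The weights are real, so swapping the arguments of the inner product leaves them unchanged.
    rw [← inner_conj_symm, hb', map_mul, Complex.conj_ofReal, inner_conj_symm]
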